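/- Let $R$ be an arbitrary associative ring with $1$; modules are unitary left $R$-modules. A unary pp formula is a formula $\varphi(x)$ of the form $\exists y_1\dots\exists y_k\,(A\bar y = \bar b\,x)$, where $A$ is an $m\times k$ matrix and $\bar b$ a column of length $m$ over $R$; it defines in each module $M$ the pp subgroup $\varphi(M)\subseteq M$ of all elements satisfying it. A submodule $M$ of $L$ is pure in $L$ if $M\cap\varphi(L)=\varphi(M)$ for all unary pp formulas $\varphi$. A module is absolutely pure if it is pure in every module containing it, and pure-injective if it is injective with respect to pure embeddings. A unary pp formula $\varphi$ is high if $\varphi(M)=M$ for every absolutely pure module $M$. The first Ulm submodule of a module $M$ is $$u(M)=\bigcap_{\varphi\ \text{high}}\varphi(M).$$ Put $u^0(M)=M$, $u^{\alpha+1}(M)=u(u^\alpha(M))$ for every ordinal $\alpha$, and $u^\delta(M)=\bigcap_{\alpha<\delta}u^\alpha(M)$ for every limit ordinal $\delta$. The Ulm length of $M$ is the smallest ordinal $\tau$ such that $u^{\tau+1}(M)=u^\tau(M)$. Theorem. Let $N$ be a pure-injective left $R$-module. Then $u(N)$ is pure-injective and has Ulm length $0$, i.e. $u(u(N))=u(N)$.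 Consequently, $N$ has Ulm length at most $1$. -/

import Mathlib

universe u v w

/-- A unary positive primitive formula for left `R`-modules:
`∃ y₁ … y_k, A y = b x`, with `A` an `m × k` matrix and `b` a column of length `m` over `R`. -/
structure PPFormula (R : Type u) where
  numEqs : ℕ
  numVars : ℕ
  A : Matrix (Fin numEqs) (Fin numVars) R
  b : Fin numEqs → R

namespace PPFormula

variable {R : Type u} [Ring R]

/-- `φ.Holds x`: the element `x` of the module `M` satisfies `φ` in `M`. -/
def Holds (φ : PPFormula R) {M : Type v} [AddCommGroup M] [Module R M] (x : M) : Prop :=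
  ∃ y : Fin φ.numVars → M, ∀ i, ∑ j, φ.A i j • y j = φ.b i • x

/-- The pp subgroup `φ(M)` defined by `φ` in the module `M`. -/
def subgroup (φ : PPFormula R) (M : Type v) [AddCommGroup M] [Module R M] : AddSubgroup M where
  carrier := {x | φ.Holds x}
  zero_mem' := ⟨0, fun i => by simp⟩
  add_mem' := by
    rintro a c ⟨y, hy⟩ ⟨z, hz⟩
    exact ⟨y + z, fun i => by simp [Finset.sum_add_distrib, hy i, hz i]⟩
  neg_mem' := by
    rintro a ⟨y, hy⟩
    exact ⟨-y, fun i => by simp [hy i]⟩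

/-- The formula `φ(r x)`. -/
def substSMul (φ : PPFormula R) (r : R) : PPFormula R where
  numEqs := φ.numEqs
  numVars := φ.numVars
  A := φ.A
  b := fun i => φ.b i * r

theorem mem_subgroup_substSMul (φ : PPFormula R) (r : R) {M : Type v} [AddCommGroup M]
    [Module R M] (x : M) : x ∈ (φ.substSMul r).subgroup M ↔ r • x ∈ φ.subgroup M := by
  change (∃ y : Fin φ.numVars → M, ∀ i, ∑ j, φ.A i j • y j = (φ.b i * r) • x) ↔
    ∃ y : Fin φ.numVars → M, ∀ i, ∑ j, φ.A i j • y j = φ.b i • r • x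
  simp only [mul_smul]

end PPFormula

/-- An injective linear map `f : M → N` is a pure embedding if its image is a pure submodule:
an element of `M` whose image lies in `φ(N)` lies in `φ(M)`, for every unary pp formula `φ`. -/
def IsPureEmbedding {R : Type u} [Ring R] {M : Type v} {N : Type w} [AddCommGroup M] [Module R M]
    [AddCommGroup N] [Module R N] (f : M →ₗ[R] N) : Prop :=
  Function.Injective f ∧
    ∀ (φ : PPFormula R) (x : M), f x ∈ φ.subgroup N → x ∈ φ.subgroup M

/-- A module is absolutely pure if it is pure in every module containing it. The containing
modules range over a universe large enough for the injective envelope of `M`. -/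
def IsAbsolutelyPure (R : Type u) [Ring R] (M : Type v) [AddCommGroup M] [Module R M] : Prop :=
  ∀ (L : Type (max u v)) [AddCommGroup L] [Module R L] (f : M →ₗ[R] L),
    Function.Injective f → IsPureEmbedding f

/-- A module is pure-injective if it is injective over pure embeddings. The test modules range
over a universe large enough for the pure-injective envelope of `N`. -/
def IsPureInjective (R : Type u) [Ring R] (N : Type v) [AddCommGroup N] [Module R N] : Prop :=
  ∀ (A B : Type (max u v)) [AddCommGroup A] [Module R A] [AddCommGroup B] [Module R B]
    (f : A →ₗ[R] B), IsPureEmbedding f → ∀ g : A →ₗ[R] N, ∃ h : B →ₗ[R] N, h ∘ₗ f = g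

/-- A unary pp formula is high if `φ(M) = M` for every absolutely pure left `R`-module `M`. The
modules `M` range over `Type (max u v)`. Whatever `v` is, this universe contains the injective
envelope of `R`, so the notion does not depend on `v`. -/
def PPFormula.IsHigh {R : Type u} [Ring R] (φ : PPFormula R) : Prop :=
  ∀ (M : Type (max u v)) [AddCommGroup M] [Module R M],
    IsAbsolutelyPure R M → φ.subgroup M = ⊤

/-- The first Ulm submodule `u(M)`: the intersection of all high pp subgroups `φ(M)`. -/
def ulm (R : Type u) [Ring R] (M : Type v) [AddCommGroup M] [Module R M] : Submodule R M where
  carrier := {x | ∀ φ : PPFormula R, PPFormula.IsHigh.{u, v} φ → x ∈ φ.subgroup M}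
  zero_mem' := fun φ _ => (φ.subgroup M).zero_mem
  add_mem' := fun ha hc φ hφ => (φ.subgroup M).add_mem (ha φ hφ) (hc φ hφ)
  smul_mem' := fun r x hx φ hφ =>
    (φ.mem_subgroup_substSMul r x).1 <| hx (φ.substSMul r) fun L _ _ hL => by
      ext z
      rw [φ.mem_subgroup_substSMul r z, hφ L hL]
      simp

/-- The first Ulm submodule `u(P)` of a submodule `P` of `M`, as a submodule of `M`. -/
def ulmOf {R : Type u} [Ring R] {M : Type v} [AddCommGroup M] [Module R M]
    (P : Submodule R M) : Submodule R M :=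
  (ulm R P).map P.subtype

/-- The Ulm sequence of `M`: `u⁰(M) = M`, `u^(α+1)(M) = u(u^α(M))`, and
`u^δ(M) = ⋂_{α < δ} u^α(M)` for limit ordinals `δ`. -/
noncomputable def ulmSeq (R : Type u) [Ring R] (M : Type v) [AddCommGroup M] [Module R M]
    (α : Ordinal.{v}) : Submodule R M :=
  Ordinal.limitRecOn (motive := fun _ => Submodule R M) α ⊤ (fun _ P => ulmOf P)
    (fun δ _ P => ⨅ β : Set.Iio δ, P β.1 β.2)

/-- `τ` is the Ulm length of `M`: the smallest ordinal with `u^(τ+1)(M) = u^τ(M)`. -/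
def HasUlmLength (R : Type u) [Ring R] (M : Type v) [AddCommGroup M] [Module R M]
    (τ : Ordinal.{v}) : Prop :=
  IsLeast {α : Ordinal.{v} | ulmSeq R M (α + 1) = ulmSeq R M α} τ

/-!
Every map from an injective module to `N` has its image in `u(N)`. When `N` is pure-injective these
images exhaust `u(N)`. This follows from the standard extension principle: a map `g : M → N` extends
along `f : M → L` as soon as every finite linear system over `M` solvable in `L` via `f` is solvable
in `N` via `g`, since then `N` is pure in the pushout of `L` and `N` over `M`.

Let `f : M → L` be a pure embedding and let `g : M → N` take its values in `u(N)`. Present `L` by a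
free module, `π : F → L`, embed `F` in an injective module `E`, and let `P` be the pushout of `π`
and `F → E`. A finite system over `M` solvable in `P` splits into one over `L`, with error terms
`π s`, and one over `E` with right-hand sides `s`. By purity the first is solvable in `M` with `π s`
replaced by `θ s` for some `θ : F → M`. The coordinates of the second give high formulas, which hold
at the values of `g`, so it is solvable in `N` with right-hand sides `g (θ s)`. Thus `g` extends to
`P`, and since `π` is onto, the extension maps `L` into the image of `E`, hence into `u(N)`. So
`u(N)` is pure-injective. For `f` the identity of `u(N)`, the argument shows that `u(N)` is a
quotient of `E`, and therefore `u(u(N)) = u(N)`.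
-/

section LinearSystems

variable {R : Type*} [Ring R] {M N L : Type*} [AddCommGroup M] [Module R M] [AddCommGroup N]
  [Module R N] [AddCommGroup L] [Module R L] {ι κ κ' ν : Type*} [Fintype κ] [Fintype κ']
  [Fintype ν]

/-- The right-hand sides `c` over `M` for which the linear system `A y = c` is solvable in `M`.
They express pp formulas in several variables: a tuple `x` satisfies `∃ y, A y = D x` in `M` if and
only if `D x` belongs to `solvableColumns A M`. -/
def solvableColumns (A : Matrix ι κ R) (M : Type*) [AddCommGroup M] [Module R M] :
    AddSubgroup (ι → M) where
  carrier := {c | ∃ y : κ → M, ∀ i, ∑ j, A i j • y j = c i}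
  zero_mem' := ⟨0, fun i => by simp⟩
  add_mem' := by
    rintro c d ⟨y, hy⟩ ⟨z, hz⟩
    exact ⟨y + z, fun i => by simp [Finset.sum_add_distrib, hy i, hz i]⟩
  neg_mem' := by
    rintro c ⟨y, hy⟩
    exact ⟨-y, fun i => by simp [hy i]⟩

theorem mem_solvableColumns {A : Matrix ι κ R} {c : ι → M} :
    c ∈ solvableColumns A M ↔ ∃ y : κ → M, ∀ i, ∑ j, A i j • y j = c i :=
  Iff.rfl

theorem PPFormula.mem_subgroup_iff {φ : PPFormula R} {x : M} :
    x ∈ φ.subgroup M ↔ (fun i => φ.b i • x) ∈ solvableColumns φ.A M :=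
  Iff.rfl

theorem comp_mem_solvableColumns {A : Matrix ι κ R} {c : ι → M} (f : M →ₗ[R] N)
    (hc : c ∈ solvableColumns A M) : f ∘ c ∈ solvableColumns A N := by
  obtain ⟨y, hy⟩ := hc
  exact ⟨f ∘ y, fun i => by simp [← hy i]⟩

theorem PPFormula.map_mem_subgroup (φ : PPFormula R) (f : M →ₗ[R] N) {x : M}
    (hx : x ∈ φ.subgroup M) : f x ∈ φ.subgroup N := by
  simpa [mem_subgroup_iff, Function.comp_def] using comp_mem_solvableColumns f hx

theorem solvableColumns_submatrix (A : Matrix ι κ R) (e : κ' ≃ κ) :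
    solvableColumns (A.submatrix id e) M = solvableColumns A M := by
  ext c
  refine (e.arrowCongr (Equiv.refl M)).exists_congr fun y => forall_congr' fun i => ?_
  rw [← e.sum_comp fun j => A i j • (e.arrowCongr (Equiv.refl M)) y j]
  simp

theorem mem_solvableColumns_fromCols {A : Matrix ι κ R} {D : Matrix ι ν R} {c : ι → M} :
    c ∈ solvableColumns (A.fromCols D) M ↔
      ∃ w : ν → M, (fun i => c i - ∑ l, D i l • w l) ∈ solvableColumns A M := by
  simp only [mem_solvableColumns, eq_sub_iff_add_eq]
  constructor
  · rintro ⟨y, hy⟩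
    exact ⟨y ∘ Sum.inr, y ∘ Sum.inl, fun i => by simpa [Fintype.sum_sum_type] using hy i⟩
  · rintro ⟨w, z, hz⟩
    exact ⟨Sum.elim z w, fun i => by simpa [Fintype.sum_sum_type] using hz i⟩

/-- Every finite linear system with right-hand sides in `M` that is solvable in `N` after applying
`f` is solvable in `L` after applying `g`. Equivalently, for every finite tuple `x` over `M` the pp
type of `f x` in `N` is contained in the pp type of `g x` in `L`. -/
def PPTypeLE (f : M →ₗ[R] N) (g : M →ₗ[R] L) : Prop :=
  ∀ ⦃m k : ℕ⦄ (A : Matrix (Fin m) (Fin k) R) (c : Fin m → M),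
    f ∘ c ∈ solvableColumns A N → g ∘ c ∈ solvableColumns A L

theorem PPTypeLE.comp_mem_of_comp_mem {f : M →ₗ[R] N} {g : M →ₗ[R] L} (h : PPTypeLE f g)
    {m : ℕ} {A : Matrix (Fin m) κ R} {c : Fin m → M} (hc : f ∘ c ∈ solvableColumns A N) :
    g ∘ c ∈ solvableColumns A L := by
  rw [← solvableColumns_submatrix A (Fintype.equivFin κ).symm] at hc ⊢
  exact h _ c hc

theorem PPTypeLE.of_comp_eq {f : M →ₗ[R] N} {g : M →ₗ[R] L} (k : N →ₗ[R] L)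
    (h : k ∘ₗ f = g) : PPTypeLE f g := by
  rintro m n A c hc
  rw [← h, LinearMap.coe_comp, Function.comp_assoc]
  exact comp_mem_solvableColumns k hc

end LinearSystems

section PureEmbeddings

variable {R : Type*} [Ring R] {M N L : Type*} [AddCommGroup M] [Module R M] [AddCommGroup N]
  [Module R N] [AddCommGroup L] [Module R L]

theorem PPTypeLE.isPureEmbedding {f : M →ₗ[R] N} (h : PPTypeLE f LinearMap.id) :
    IsPureEmbedding f := by
  refine ⟨(injective_iff_map_eq_zero f).2 fun x hx => ?_, fun φ x hx => ?_⟩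
  · -- The system `0 = x` without unknowns is solvable exactly when `x = 0`.
    obtain ⟨_, hy⟩ := h (m := 1) (k := 0) 0 (fun _ => x) ⟨0, fun _ => by simp [hx]⟩
    simpa using (hy 0).symm
  · refine h φ.A (fun i => φ.b i • x) ?_
    simpa [Function.comp_def] using PPFormula.mem_subgroup_iff.1 hx

theorem IsPureEmbedding.ppTypeLE {f : M →ₗ[R] N} (hf : IsPureEmbedding f) :
    PPTypeLE f LinearMap.id := by
  intro m
  induction m with
  | zero => exact fun k A c _ => ⟨0, fun i => i.elim0⟩
  | succ m ih =>
    rintro k A c ⟨y, hy⟩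
    obtain ⟨z, hz⟩ := ih (A.submatrix Fin.succ id) (c ∘ Fin.succ) ⟨y, fun i => hy i.succ⟩
    -- `z` solves all equations but the first; what it misses there satisfies a unary pp formula.
    let x := c 0 - ∑ j, A 0 j • z j
    let φ : PPFormula R := ⟨m + 1, k, A, Pi.single 0 1⟩
    have hx : f x ∈ φ.subgroup N := by
      refine ⟨y - f ∘ z, Fin.cases ?_ fun i => ?_⟩
      · simpa [φ, x, smul_sub] using hy 0
      · have hzi : ∑ j, A i.succ j • f (z j) = f (c i.succ) := by
          simpa using congrArg f (hz i)
        simpa [φ, smul_sub, hzi, sub_eq_zero] using hy i.succ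
    obtain ⟨z', hz'⟩ := hf.2 φ x hx
    refine ⟨z + z', Fin.cases ?_ fun i => ?_⟩
    · simpa [φ, x, Finset.sum_add_distrib, eq_sub_iff_add_eq'] using hz' 0
    · simpa [φ, Finset.sum_add_distrib, hz' i.succ] using hz i

theorem isPureEmbedding_of_leftInverse {f : M →ₗ[R] N} (g : N →ₗ[R] M)
    (h : Function.LeftInverse g f) : IsPureEmbedding f :=
  (PPTypeLE.of_comp_eq g (LinearMap.ext h : g ∘ₗ f = LinearMap.id)).isPureEmbedding

theorem IsPureEmbedding.comp {f : M →ₗ[R] N} {g : N →ₗ[R] L} (hg : IsPureEmbedding g)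
    (hf : IsPureEmbedding f) : IsPureEmbedding (g ∘ₗ f) :=
  ⟨hg.1.comp hf.1, fun φ x hx => hf.2 φ x (hg.2 φ (f x) hx)⟩

theorem map_eq_sum_of_support_subset {X : Type*} (θ : (X →₀ R) →ₗ[R] M) {s : X →₀ R}
    {S : Finset X} (hS : s.support ⊆ S) : θ s = ∑ x ∈ S, s x • θ (Finsupp.single x 1) := by
  conv_lhs => rw [← s.sum_single, Finsupp.sum_of_support_subset s hS _ (by simp), map_sum]
  simp [← map_smul]

theorem IsPureEmbedding.exists_add_comp_mem_solvableColumns {f : M →ₗ[R] N}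
    (hf : IsPureEmbedding f) {X κ : Type*} [Fintype κ] (π : (X →₀ R) →ₗ[R] N) {m : ℕ}
    {A : Matrix (Fin m) κ R} {c : Fin m → M} {s : Fin m → X →₀ R}
    (h : f ∘ c + π ∘ s ∈ solvableColumns A N) :
    ∃ θ : (X →₀ R) →ₗ[R] M, c + θ ∘ s ∈ solvableColumns A M := by
  obtain ⟨S, hS⟩ := Finite.exists_le fun i => (s i).support
  -- The values of `π` at the finitely many basis elements in `S` become further unknowns.
  let D : Matrix (Fin m) S R := fun i x => -s i x
  have hN : f ∘ c ∈ solvableColumns (A.fromCols D) N := by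
    refine mem_solvableColumns_fromCols.2 ⟨fun x => π (Finsupp.single x 1), ?_⟩
    convert h using 2 with i
    simp [D, map_eq_sum_of_support_subset π (hS i), ← Finset.sum_coe_sort S]
  obtain ⟨w, hw⟩ := mem_solvableColumns_fromCols.1 (hf.ppTypeLE.comp_mem_of_comp_mem hN)
  let θ := Finsupp.linearCombination R (Function.extend Subtype.val w 0)
  have hθ : ∀ i, θ (s i) = ∑ x : S, s i x • w x := fun i => by
    simp [map_eq_sum_of_support_subset θ (hS i), ← Finset.sum_coe_sort S, θ]
  refine ⟨θ, ?_⟩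
  convert hw using 2 with i
  simp [D, hθ]

end PureEmbeddings

/-- The pushout of `f` and `g`, encoded as the quotient of `M × N` by all `(f x, -g x)`. -/
abbrev ModulePushout {R K M N : Type*} [Ring R] [AddCommGroup K] [Module R K] [AddCommGroup M]
    [Module R M] [AddCommGroup N] [Module R N] (f : K →ₗ[R] M) (g : K →ₗ[R] N) : Type _ :=
  (M × N) ⧸ LinearMap.range (f.prod (-g))

namespace ModulePushout

variable {R K M N : Type*} [Ring R] [AddCommGroup K] [Module R K] [AddCommGroup M] [Module R M]
  [AddCommGroup N] [Module R N] (f : K →ₗ[R] M) (g : K →ₗ[R] N)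

/-- The coprojection of the first module into the pushout. -/
def inl : M →ₗ[R] ModulePushout f g :=
  Submodule.mkQ _ ∘ₗ LinearMap.inl R M N

/-- The coprojection of the second module into the pushout. -/
def inr : N →ₗ[R] ModulePushout f g :=
  Submodule.mkQ _ ∘ₗ LinearMap.inr R M N

theorem inl_comp_eq_inr_comp : inl f g ∘ₗ f = inr f g ∘ₗ g := by
  ext x
  refine (Submodule.Quotient.eq _).2 ⟨x, ?_⟩
  simp

variable {f g}

theorem exists_of_inl_comp_mem_solvableColumns {ι κ : Type*} [Fintype κ] {A : Matrix ι κ R}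
    {c : ι → M} (h : inl f g ∘ c ∈ solvableColumns A (ModulePushout f g)) :
    ∃ s : ι → K, c + f ∘ s ∈ solvableColumns A M ∧ g ∘ s ∈ solvableColumns A N := by
  obtain ⟨y, hy⟩ := h
  choose y' hy' using fun j => Submodule.mkQ_surjective _ (y j)
  have hrel : ∀ i, ∑ j, A i j • y' j - (c i, 0) ∈ LinearMap.range (f.prod (-g)) := fun i => by
    rw [← Submodule.Quotient.eq, ← Submodule.mkQ_apply, map_sum]
    simpa [← hy', inl] using hy i
  choose s hs using hrel
  have hfst : ∀ i, f (s i) = ∑ j, A i j • (y' j).1 - c i := fun i => by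
    simpa [Prod.fst_sum] using congrArg Prod.fst (hs i)
  have hsnd : ∀ i, -g (s i) = ∑ j, A i j • (y' j).2 := fun i => by
    simpa [Prod.snd_sum] using congrArg Prod.snd (hs i)
  refine ⟨s, ⟨fun j => (y' j).1, fun i => by simp [hfst]⟩, neg_mem_iff.1 ?_⟩
  exact ⟨fun j => (y' j).2, fun i => (hsnd i).symm⟩

theorem isPureEmbedding_inl (h : PPTypeLE g f) : IsPureEmbedding (inl f g) := by
  refine PPTypeLE.isPureEmbedding fun m k A c hc => ?_
  obtain ⟨s, hs, hgs⟩ := exists_of_inl_comp_mem_solvableColumns hc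
  simpa using sub_mem hs (h A s hgs)

end ModulePushout

section PureInjectives

variable {R : Type u} [Ring R] {N : Type v} [AddCommGroup N] [Module R N]

theorem IsPureInjective.exists_leftInverse (hN : IsPureInjective R N) {L : Type (max u v)}
    [AddCommGroup L] [Module R L] {f : N →ₗ[R] L} (hf : IsPureEmbedding f) :
    ∃ r : L →ₗ[R] N, r ∘ₗ f = LinearMap.id := by
  let d : ULift.{u} N ≃ₗ[R] N := ULift.moduleEquiv
  have hd : IsPureEmbedding d.toLinearMap :=
    isPureEmbedding_of_leftInverse d.symm.toLinearMap d.symm_apply_apply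
  obtain ⟨r, hr⟩ := hN _ L _ (hf.comp hd) d.toLinearMap
  exact ⟨r, LinearMap.ext fun x => by simpa using LinearMap.congr_fun hr (d.symm x)⟩

theorem IsPureInjective.exists_extension (hN : IsPureInjective R N) {M : Type*}
    {L : Type (max u v)} [AddCommGroup M] [Module R M] [AddCommGroup L] [Module R L]
    {f : M →ₗ[R] L} {g : M →ₗ[R] N} (h : PPTypeLE f g) : ∃ k : L →ₗ[R] N, k ∘ₗ f = g := by
  obtain ⟨r, hr⟩ := hN.exists_leftInverse (ModulePushout.isPureEmbedding_inl h)
  refine ⟨r ∘ₗ ModulePushout.inr g f, ?_⟩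
  rw [LinearMap.comp_assoc, ← ModulePushout.inl_comp_eq_inr_comp, ← LinearMap.comp_assoc, hr,
    LinearMap.id_comp]

end PureInjectives

section Ulm

variable {R : Type u} [Ring R]

theorem isAbsolutelyPure_of_injective {E : Type (max u v)} [AddCommGroup E] [Module R E]
    (hE : Module.Injective R E) : IsAbsolutelyPure R E := by
  intro L _ _ f hf
  obtain ⟨g, hg⟩ := hE.out f hf LinearMap.id
  exact isPureEmbedding_of_leftInverse g hg

variable (R) in
theorem exists_injective_embedding (M : Type (max u v)) [AddCommGroup M] [Module R M] :
    ∃ (E : Type (max u v)) (_ : AddCommGroup E) (_ : Module R E) (e : M →ₗ[R] E),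
      Module.Injective R E ∧ Function.Injective e := by
  obtain ⟨⟨J, hJ, f, hf⟩⟩ :=
    (ModuleCat.enoughInjectives.{max u v, u} R).presentation (ModuleCat.of R M)
  exact ⟨J, inferInstance, inferInstance, f.hom,
    Module.injective_module_of_injective_object R J, (ModuleCat.mono_iff_injective f).1 hf⟩

theorem PPFormula.isHigh_of_comp_mem_solvableColumns {F E : Type (max u v)} [AddCommGroup F]
    [Module R F] [AddCommGroup E] [Module R E] {e : F →ₗ[R] E} (he : Function.Injective e)
    {m k : ℕ} {A : Matrix (Fin m) (Fin k) R} {s : Fin m → F}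
    (hs : e ∘ s ∈ solvableColumns A E) (p : F →ₗ[R] R) :
    PPFormula.IsHigh.{u, v} ⟨m, k, A, p ∘ s⟩ := by
  intro M _ _ hM
  refine eq_top_iff.2 fun x _ => ?_
  obtain ⟨L, _, _, i, hL, hi⟩ := exists_injective_embedding.{u, v} R M
  obtain ⟨t, ht⟩ := hL.out e he (i ∘ₗ LinearMap.toSpanSingleton R M x ∘ₗ p)
  refine (hM L i hi).2 _ x ?_
  have hcolumn : t ∘ e ∘ s = fun l => p (s l) • i x := by
    ext l
    simp [ht]
  exact PPFormula.mem_subgroup_iff.2 (hcolumn ▸ comp_mem_solvableColumns t hs)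

theorem comp_mem_solvableColumns_of_mem_ulm {N : Type v} [AddCommGroup N] [Module R N]
    {X E : Type (max u v)} [AddCommGroup E] [Module R E] {e : (X →₀ R) →ₗ[R] E}
    (he : Function.Injective e) {m k : ℕ} {A : Matrix (Fin m) (Fin k) R} {s : Fin m → X →₀ R}
    (hs : e ∘ s ∈ solvableColumns A E) {θ : (X →₀ R) →ₗ[R] N} (hθ : ∀ x, θ x ∈ ulm R N) :
    θ ∘ s ∈ solvableColumns A N := by
  obtain ⟨S, hS⟩ := Finite.exists_le fun i => (s i).support
  have hsum : θ ∘ s = ∑ x ∈ S, fun i => s i x • θ (Finsupp.single x 1) := by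
    ext i
    simp [map_eq_sum_of_support_subset θ (hS i)]
  rw [hsum]
  refine sum_mem fun x _ => ?_
  have hhigh := PPFormula.isHigh_of_comp_mem_solvableColumns.{u, v} he hs (Finsupp.lapply x)
  exact hθ (Finsupp.single x 1) _ hhigh

theorem IsPureEmbedding.ppTypeLE_pushout {N : Type v} [AddCommGroup N] [Module R N]
    {X E : Type (max u v)} [AddCommGroup E] [Module R E] {M L : Type*} [AddCommGroup M]
    [Module R M] [AddCommGroup L] [Module R L] {f : M →ₗ[R] L} (hf : IsPureEmbedding f)
    {g : M →ₗ[R] N} (hg : ∀ a, g a ∈ ulm R N) (π : (X →₀ R) →ₗ[R] L) {e : (X →₀ R) →ₗ[R] E}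
    (he : Function.Injective e) : PPTypeLE (ModulePushout.inl π e ∘ₗ f) g := by
  intro m k A c hc
  obtain ⟨s, hfs, hes⟩ := ModulePushout.exists_of_inl_comp_mem_solvableColumns (c := f ∘ c) hc
  obtain ⟨θ, hθ⟩ := hf.exists_add_comp_mem_solvableColumns π hfs
  have hgθ : (g ∘ₗ θ) ∘ s ∈ solvableColumns A N :=
    comp_mem_solvableColumns_of_mem_ulm he hes fun x => hg (θ x)
  convert sub_mem (comp_mem_solvableColumns g hθ) hgθ using 1
  ext i
  simp

variable {N : Type v} [AddCommGroup N] [Module R N]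

theorem IsPureInjective.exists_extension_range_le (hN : IsPureInjective R N) {M : Type*}
    {L : Type (max u v)} [AddCommGroup M] [Module R M] [AddCommGroup L] [Module R L]
    {f : M →ₗ[R] L} (hf : IsPureEmbedding f) {g : M →ₗ[R] N} (hg : ∀ a, g a ∈ ulm R N) :
    ∃ (E : Type (max u v)) (_ : AddCommGroup E) (_ : Module R E) (k : E →ₗ[R] N) (h : L →ₗ[R] N),
      Module.Injective R E ∧ h ∘ₗ f = g ∧ LinearMap.range h ≤ LinearMap.range k := by
  obtain ⟨E, _, _, e, hE, he⟩ := exists_injective_embedding.{u, v} R (L →₀ R)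
  let π : (L →₀ R) →ₗ[R] L := Finsupp.linearCombination R id
  obtain ⟨t, ht⟩ := hN.exists_extension (hf.ppTypeLE_pushout hg π he)
  refine ⟨E, _, _, t ∘ₗ ModulePushout.inr π e, t ∘ₗ ModulePushout.inl π e, hE, ht, ?_⟩
  rintro _ ⟨b, rfl⟩
  have hb := LinearMap.congr_fun (ModulePushout.inl_comp_eq_inr_comp π e) (Finsupp.single b 1)
  exact ⟨e (Finsupp.single b 1), by simpa [π] using congrArg t hb.symm⟩

theorem range_le_ulm {E : Type (max u v)} [AddCommGroup E] [Module R E]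
    (hE : IsAbsolutelyPure R E) (k : E →ₗ[R] N) : LinearMap.range k ≤ ulm R N := by
  rintro _ ⟨x, rfl⟩ φ hφ
  exact φ.map_mem_subgroup k (hφ E hE ▸ AddSubgroup.mem_top x)

theorem IsPureInjective.isPureInjective_ulm (hN : IsPureInjective R N) :
    IsPureInjective R (ulm R N) := by
  intro A B _ _ _ _ f hf g
  obtain ⟨E, _, _, k, h, hE, hext, hrange⟩ :=
    hN.exists_extension_range_le hf (g := (ulm R N).subtype ∘ₗ g) fun a => (g a).2
  have hu : ∀ b, h b ∈ ulm R N := fun b =>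
    range_le_ulm (isAbsolutelyPure_of_injective hE) k (hrange (LinearMap.mem_range_self h b))
  exact ⟨h.codRestrict _ hu, LinearMap.ext fun a => Subtype.ext (LinearMap.congr_fun hext a)⟩

theorem IsPureInjective.exists_injective_range_eq_ulm (hN : IsPureInjective R N) :
    ∃ (E : Type (max u v)) (_ : AddCommGroup E) (_ : Module R E) (k : E →ₗ[R] N),
      Module.Injective R E ∧ LinearMap.range k = ulm R N := by
  let d : ULift.{u} (ulm R N) ≃ₗ[R] ulm R N := ULift.moduleEquiv
  obtain ⟨E, _, _, k, h, hE, hext, hrange⟩ := hN.exists_extension_range_le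
    (isPureEmbedding_of_leftInverse d.toLinearMap d.apply_symm_apply)
    (g := (ulm R N).subtype) Subtype.property
  refine ⟨E, _, _, k, hE,
    (range_le_ulm (isAbsolutelyPure_of_injective hE) k).antisymm fun x hx => hrange ?_⟩
  exact ⟨d.symm ⟨x, hx⟩, LinearMap.congr_fun hext ⟨x, hx⟩⟩

theorem IsPureInjective.ulm_ulm_eq_top (hN : IsPureInjective R N) : ulm R (ulm R N) = ⊤ := by
  obtain ⟨E, _, _, k, hE, hk⟩ := hN.exists_injective_range_eq_ulm
  rw [← hk, eq_top_iff, ← k.range_rangeRestrict]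
  exact range_le_ulm (isAbsolutelyPure_of_injective hE) k.rangeRestrict

end Ulm

section UlmLength

variable {R : Type u} [Ring R] {M N : Type v} [AddCommGroup M] [Module R M] [AddCommGroup N]
  [Module R N]

theorem map_ulm_le (f : M →ₗ[R] N) : (ulm R M).map f ≤ ulm R N := by
  rintro _ ⟨x, hx, rfl⟩ φ hφ
  exact φ.map_mem_subgroup f (hx φ hφ)

theorem ulmOf_eq_self {P : Submodule R M} (h : ulm R P = ⊤) : ulmOf P = P := by
  rw [ulmOf, h, Submodule.map_subtype_top]

theorem ulmOf_top : ulmOf (⊤ : Submodule R M) = ulm R M := by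
  refine (map_ulm_le _).antisymm fun x hx => ⟨⟨x, trivial⟩, ?_, rfl⟩
  exact map_ulm_le Submodule.topEquiv.symm.toLinearMap ⟨x, hx, rfl⟩

theorem ulmSeq_zero : ulmSeq R M 0 = ⊤ :=
  Ordinal.limitRecOn_zero ..

theorem ulmSeq_add_one (α : Ordinal.{v}) : ulmSeq R M (α + 1) = ulmOf (ulmSeq R M α) :=
  Ordinal.limitRecOn_add_one ..

theorem ulmSeq_one : ulmSeq R M 1 = ulm R M := by
  rw [← zero_add 1, ulmSeq_add_one, ulmSeq_zero, ulmOf_top]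

theorem hasUlmLength_zero_iff : HasUlmLength R M 0 ↔ ulm R M = ⊤ := by
  simp [HasUlmLength, IsLeast, lowerBounds, ulmSeq_zero, ulmSeq_one]

theorem exists_hasUlmLength_le {α : Ordinal.{v}} (h : ulmSeq R M (α + 1) = ulmSeq R M α) :
    ∃ τ : Ordinal.{v}, HasUlmLength R M τ ∧ τ ≤ α :=
  ⟨_, ⟨csInf_mem ⟨α, h⟩, fun _ hβ => csInf_le' hβ⟩, csInf_le' h⟩

end UlmLength

theorem mainTheorem5 {R : Type u} [Ring R] {N : Type v} [AddCommGroup N] [Module R N]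
    (hN : IsPureInjective R N) :
    IsPureInjective R (ulm R N) ∧
      HasUlmLength R (ulm R N) 0 ∧
      ulmOf (ulm R N) = ulm R N ∧
      ∃ τ : Ordinal.{v}, HasUlmLength R N τ ∧ τ ≤ 1 := by
  have hstable : ulmOf (ulm R N) = ulm R N := ulmOf_eq_self hN.ulm_ulm_eq_top
  have hseq : ulmSeq R N (1 + 1) = ulmSeq R N 1 := by rw [ulmSeq_add_one, ulmSeq_one, hstable]
  exact ⟨hN.isPureInjective_ulm, hasUlmLength_zero_iff.2 hN.ulm_ulm_eq_top, hstable,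
    exists_hasUlmLength_le hseq⟩
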